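/- For $n\ge 0$ let $\mathbf{Iv}_n(123)$ be the set of permutations $\sigma$ of $\{1,\dots,n\}$ such that $\sigma^{-1}=\sigma$ and $\sigma$ avoids the pattern $123$, i.e. there are no $i<j<k$ with $\sigma(i)<\sigma(j)<\sigma(k)$ (for $n=0$ this is the set consisting of the empty permutation). Let $\mathrm{fp}(\sigma)$ be the number of fixed points of $\sigma$ and $|\sigma|=n$ its size. Then, as an identity of formal power series in $t$ with coefficients in $\mathbb{Q}[x]$ (the quotient being taken in the field of fractions of $\mathbb{Q}[x][[t]]$), $$\sum_{n\ge 0}\ \sum_{\sigma\in\mathbf{Iv}_n(123)} x^{\mathrm{fp}(\sigma)}\,t^{|\sigma|} \;=\; 1+\bigl(tx+t^2(1+x^2)\bigr)\,\frac{1-\sqrt{1-4t^2}}{2t^2\sqrt{1-4t^2}},$$ where $\sqrt{1-4t^2}$ denotes the unique power series in $\mathbb{Q}[x][[t]]$ with constant term $1$ whose square is $1-4t^2$. -/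

import Mathlib

noncomputable section

/-- The permutation `π` of an `n`-element chain contains the pattern `τ ∈ S_k`: there are positions
`i_1 < ⋯ < i_k` at which the entries of `π` have the same relative order as `τ`. -/
def ContainsPattern {n k : ℕ} (π : Equiv.Perm (Fin n)) (τ : Equiv.Perm (Fin k)) : Prop :=
  ∃ i : Fin k → Fin n, StrictMono i ∧ ∀ a b : Fin k, π (i a) < π (i b) ↔ τ a < τ b

/-- The permutation `π` avoids the pattern `τ`. -/
def AvoidsPattern {n k : ℕ} (π : Equiv.Perm (Fin n)) (τ : Equiv.Perm (Fin k)) : Prop :=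
  ¬ ContainsPattern π τ

open Classical in
/-- The finite set of `τ`-avoiding involutions (permutations equal to their inverse) of an
`n`-element chain. -/
def avoidingInvolutions {k : ℕ} (τ : Equiv.Perm (Fin k)) (n : ℕ) : Finset (Equiv.Perm (Fin n)) :=
  Finset.univ.filter fun π => π⁻¹ = π ∧ AvoidsPattern π τ

/-- The number of fixed points of a permutation. -/
def numFixedPoints {n : ℕ} (π : Equiv.Perm (Fin n)) : ℕ :=
  (Finset.univ.filter fun i => π i = i).card

/-- The bivariate generating function `∑ x ^ fp(σ) * t ^ |σ|` over all `τ`-avoiding involutions `σ`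
of all sizes `|σ| = n ≥ 0`, as a formal power series in `t` with coefficients in `ℚ[x]`. -/
def fixedPointSeries {k : ℕ} (τ : Equiv.Perm (Fin k)) : PowerSeries (Polynomial ℚ) :=
  PowerSeries.mk fun n =>
    ∑ σ ∈ avoidingInvolutions τ n, (Polynomial.X : Polynomial ℚ) ^ numFixedPoints σ

/-- The pattern `123`, the identity of `S_3`. -/
def pattern123 : Equiv.Perm (Fin 3) := 1

/-- `S` is the formal square root of the power series `A` with constant term `1`. -/
def IsFormalSqrt (A S : PowerSeries (Polynomial ℚ)) : Prop :=
  PowerSeries.constantCoeff S = 1 ∧ S ^ 2 = A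

/-- The field of fractions of `ℚ[x]⟦t⟧`. -/
abbrev FormalQuotients : Type := FractionRing (PowerSeries (Polynomial ℚ))

/-- A power series in `t` over `ℚ[x]`, as an element of the field of fractions of `ℚ[x]⟦t⟧`. -/
def toQuot (f : PowerSeries (Polynomial ℚ)) : FormalQuotients :=
  algebraMap (PowerSeries (Polynomial ℚ)) FormalQuotients f

/-- The variable `t` of `ℚ[x]⟦t⟧`. -/
def tVar : PowerSeries (Polynomial ℚ) := PowerSeries.X

/-- The variable `x` of `ℚ[x]⟦t⟧`. -/
def xVar : PowerSeries (Polynomial ℚ) := PowerSeries.C Polynomial.X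

end

/-! Refine the count by the length of a decreasing prefix: let D(n, k) be the fixed-point weight of
the 123-avoiding involutions of size n that decrease on their first k positions
(`decreasingWeight`). Look at the image of the last position. If it is fixed, everything before it
must decrease. If it is exchanged with position p, the entry at p is maximal, so everything before p
must decrease, and deleting the 2-cycle leaves an involution of the same kind. This expresses D(n+2,
k+1) as a sum over p (`decreasingWeight_add_two`), and subtracting consecutive instances gives
D(n+2, k+1) = D(n, k) + D(n+2, k+2) for k < n.

With h = k as height and n - k as number of steps, this is the recursion for nonnegative lattice
paths, and D(n, 0) = D(n, 1) is its boundary rule at height 0. The initial values contribute a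
factor x for odd n and 1 + x² for even n, so D(2m+1, 0) and D(2m+2, 0) are x and 1 + x² times the
number of paths of 2m+1 steps from height 0, which is binom(2m+1, m). The closed form follows from
the central binomial series being (1 - 4t)^(-1/2). -/

/-! ### Counting nonnegative lattice paths -/

/-- The number of lattice paths with `N` steps `±1` that start at height `h` and never go below
height `0`. -/
def ballotPaths : ℕ → ℕ → ℕ
  | 0, _ => 1
  | N + 1, 0 => ballotPaths N 1
  | N + 1, h + 1 => ballotPaths N h + ballotPaths N (h + 2)

theorem sum_range_succ_choose_succ (N a : ℕ) :
    ∑ i ∈ Finset.range (a + 1), (N + 1).choose i =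
      ∑ i ∈ Finset.range (a + 1), N.choose i + ∑ i ∈ Finset.range a, N.choose i := by
  rw [Finset.sum_range_succ', Finset.sum_range_succ' (fun i => N.choose i)]
  simp only [Nat.choose_succ_succ, Finset.sum_add_distrib, Nat.choose_zero_right]
  ring

theorem sum_range_choose_succ (N a : ℕ) :
    ∑ i ∈ Finset.range a, (N + 1).choose i =
      ∑ i ∈ Finset.range a, N.choose i + ∑ i ∈ Finset.range (a - 1), N.choose i := by
  cases a with
  | zero => simp
  | succ a => exact sum_range_succ_choose_succ N a

/-- The reflection principle, stated without subtracting the sums. Here `i` counts down-steps: the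
right side counts all paths from `h` ending at height at least 0, and the sum on the left counts
those that visit -1, reflected to start at `-2 - h`. Truncated subtraction makes that sum empty when
`N < h`. -/
theorem ballotPaths_add_sum_choose (N h : ℕ) :
    ballotPaths N h + ∑ i ∈ Finset.range ((N + h) / 2 - h), N.choose i =
      ∑ i ∈ Finset.range ((N + h) / 2 + 1), N.choose i := by
  induction N generalizing h with
  | zero =>
    have : (0 + h) / 2 - h = 0 := by omega
    rw [this, Finset.sum_range_succ']
    simp [ballotPaths]
  | succ N ih =>
    rw [sum_range_succ_choose_succ, sum_range_choose_succ]
    cases h with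
    | zero =>
      have := ih 1
      simp only [ballotPaths, Nat.sub_zero, add_zero] at this ⊢
      omega
    | succ h =>
      have h1 := ih h
      have h2 := ih (h + 2)
      have e1 : (N + 1 + (h + 1)) / 2 = (N + h) / 2 + 1 := by omega
      have e2 : (N + (h + 2)) / 2 = (N + h) / 2 + 1 := by omega
      have e3 : (N + h) / 2 + 1 - (h + 1) = (N + h) / 2 - h := by omega
      have e4 : (N + h) / 2 + 1 - (h + 2) = (N + h) / 2 - h - 1 := by omega
      rw [e2, e4] at h2
      rw [e1, e3]
      simp only [ballotPaths]
      omega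

theorem ballotPaths_two_mul_add_one_zero (m : ℕ) :
    ballotPaths (2 * m + 1) 0 = (2 * m + 1).choose m := by
  have h := ballotPaths_add_sum_choose (2 * m + 1) 0
  have e : (2 * m + 1 + 0) / 2 = m := by omega
  rw [e, Finset.sum_range_succ, Nat.sub_zero] at h
  omega

/-! ### Central binomial series and the formal square root -/

section Series

open PowerSeries

/-- The generating series of the central binomial coefficients. -/
noncomputable def centralBinomSeries (R : Type*) [CommRing R] : PowerSeries R :=
  mk fun m => (m.centralBinom : R)

/-- The generating series of the binomial coefficients `(2 m + 1).choose m`. -/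
noncomputable def oddCentralBinomSeries (R : Type*) [CommRing R] : PowerSeries R :=
  mk fun m => ((2 * m + 1).choose m : R)

theorem derivative_centralBinomSeries (R : Type*) [CommRing R] :
    (1 - 4 * X) * d⁄dX R (centralBinomSeries R) = 2 * centralBinomSeries R := by
  have h4 : (4 : PowerSeries R) = C 4 := (map_ofNat C 4).symm
  have h2 : (2 : PowerSeries R) = C 2 := (map_ofNat C 2).symm
  ext1 n
  have key := fun m : ℕ => congrArg (Nat.cast (R := R)) (Nat.succ_mul_centralBinom_succ m)
  rw [sub_mul, one_mul, h4, h2, mul_assoc, map_sub, coeff_C_mul, coeff_C_mul]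
  cases n with
  | zero => simp [coeff_derivative, centralBinomSeries, Nat.centralBinom]
  | succ n =>
    rw [coeff_succ_X_mul]
    simp only [coeff_derivative, centralBinomSeries, coeff_mk]
    have := key (n + 1)
    push_cast at this ⊢
    linear_combination this

/-- The differential equation `derivative_centralBinomSeries` makes the derivative of the left side
vanish; without additive torsion, the constant term then decides. -/
theorem centralBinomSeries_sq (R : Type*) [CommRing R] [IsAddTorsionFree R] :
    centralBinomSeries R ^ 2 * (1 - 4 * X) = 1 := by
  have h4 : (4 : PowerSeries R) = C 4 := (map_ofNat C 4).symm
  apply derivative.ext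
  · have hd := derivative_centralBinomSeries R
    have h4' : d⁄dX R (4 : PowerSeries R) = 0 := by rw [h4, derivative_C]
    rw [Derivation.leibniz, derivative_one, derivative_pow, map_sub, Derivation.leibniz,
      derivative_one, derivative_X, h4']
    simp only [smul_eq_mul]
    push_cast
    linear_combination 2 * centralBinomSeries R * hd
  · simp [centralBinomSeries]

theorem centralBinomSeries_eq (R : Type*) [CommRing R] :
    centralBinomSeries R = 1 + 2 * X * oddCentralBinomSeries R := by
  have h2 : (2 : PowerSeries R) = C 2 := (map_ofNat C 2).symm
  ext1 n
  rw [h2, mul_assoc, map_add, coeff_C_mul]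
  cases n with
  | zero => simp [centralBinomSeries]
  | succ n =>
    rw [coeff_succ_X_mul]
    simp only [centralBinomSeries, oddCentralBinomSeries, coeff_mk, coeff_one]
    have : (n + 1).centralBinom = 2 * (2 * n + 1).choose n := by
      rw [Nat.centralBinom, show 2 * (n + 1) = 2 * n + 1 + 1 by ring, Nat.choose_succ_succ,
        ← Nat.choose_symm_half]
      ring
    rw [this]
    simp

theorem expand_centralBinomSeries_sq (R : Type*) [CommRing R] [IsAddTorsionFree R] :
    expand 2 two_ne_zero (centralBinomSeries R) ^ 2 * (1 - 4 * X ^ 2) = 1 := by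
  have := congrArg (expand 2 two_ne_zero) (centralBinomSeries_sq R)
  simpa only [map_mul, map_pow, map_sub, map_one, map_ofNat, expand_X] using this

theorem expand_centralBinomSeries_eq (R : Type*) [CommRing R] :
    expand 2 two_ne_zero (centralBinomSeries R) =
      1 + 2 * X ^ 2 * expand 2 two_ne_zero (oddCentralBinomSeries R) := by
  have := congrArg (expand 2 two_ne_zero) (centralBinomSeries_eq R)
  simpa only [map_mul, map_add, map_one, map_ofNat, expand_X] using this

theorem isFormalSqrt_unique {A S T : PowerSeries (Polynomial ℚ)} (hS : IsFormalSqrt A S)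
    (hT : IsFormalSqrt A T) : S = T := by
  rcases sq_eq_sq_iff_eq_or_eq_neg.1 (hS.2.trans hT.2.symm) with h | h
  · exact h
  · have := congrArg constantCoeff h
    rw [map_neg, hS.1, hT.1] at this
    norm_num at this

/-- Multiplying the inverse square root by `1 - 4 * tVar ^ 2` gives the square root itself, with no
inversion of power series. -/
theorem isFormalSqrt_expand_centralBinomSeries_mul :
    IsFormalSqrt (1 - 4 * tVar ^ 2)
      (expand 2 two_ne_zero (centralBinomSeries (Polynomial ℚ)) * (1 - 4 * tVar ^ 2)) := by
  constructor
  · rw [map_mul, constantCoeff_expand]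
    simp [centralBinomSeries, tVar]
  · rw [tVar]
    linear_combination (1 - 4 * X ^ 2) * expand_centralBinomSeries_sq (Polynomial ℚ)

/-- Writing C for the central binomial series in t², one has S C = 1, so (1 - S)/S = C - 1, and C -
1 is 2t² times the odd series in t². -/
theorem one_sub_formalSqrt {S : PowerSeries (Polynomial ℚ)}
    (hS : IsFormalSqrt (1 - 4 * tVar ^ 2) S) :
    1 - S = expand 2 two_ne_zero (oddCentralBinomSeries (Polynomial ℚ)) * (2 * tVar ^ 2 * S) := by
  rw [isFormalSqrt_unique hS isFormalSqrt_expand_centralBinomSeries_mul]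
  rw [tVar]
  have h := expand_centralBinomSeries_eq (Polynomial ℚ)
  have h' := expand_centralBinomSeries_sq (Polynomial ℚ)
  linear_combination (-1 : PowerSeries (Polynomial ℚ)) * h' +
    (expand 2 two_ne_zero (centralBinomSeries (Polynomial ℚ)) * (1 - 4 * X ^ 2)) * h

theorem eq_series_of_coeff {f : PowerSeries (Polynomial ℚ)} (h0 : coeff 0 f = 1)
    (hodd : ∀ m, coeff (2 * m + 1) f = Polynomial.X * ((2 * m + 1).choose m : Polynomial ℚ))
    (heven : ∀ m, coeff (2 * m + 2) f =
      (1 + Polynomial.X ^ 2) * ((2 * m + 1).choose m : Polynomial ℚ)) :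
    f = 1 + (tVar * xVar + tVar ^ 2 * (1 + xVar ^ 2)) *
      expand 2 two_ne_zero (oddCentralBinomSeries (Polynomial ℚ)) := by
  set B := expand 2 two_ne_zero (oddCentralBinomSeries (Polynomial ℚ)) with hB
  have hBe : ∀ m, coeff (2 * m) B = ((2 * m + 1).choose m : Polynomial ℚ) := by
    intro m
    rw [hB, coeff_expand_mul]
    simp [oddCentralBinomSeries]
  have hBo : ∀ m, coeff (2 * m + 1) B = 0 := by
    intro m
    rw [hB, coeff_expand_of_not_dvd]
    omega
  -- `B` has only even powers, so after one factor `X` is split off the two summands feed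
  -- coefficients of opposite parity.
  have e : (tVar * xVar + tVar ^ 2 * (1 + xVar ^ 2)) * B =
      X * (C Polynomial.X * B + X * (C (1 + Polynomial.X ^ 2) * B)) := by
    simp only [tVar, xVar, map_add, map_pow, map_one]
    ring
  rw [e]
  ext1 n
  rcases n with _ | n
  · simpa using h0
  rw [map_add, coeff_succ_X_mul, map_add, coeff_C_mul, coeff_one, if_neg n.succ_ne_zero, zero_add]
  rcases n with _ | n
  · have h1 := hodd 0
    have h2 := hBe 0
    simp only [mul_zero, zero_add] at h1 h2
    rw [zero_add, h1, h2]
    simp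
  rw [coeff_succ_X_mul, coeff_C_mul]
  rcases Nat.even_or_odd' n with ⟨m, rfl | rfl⟩
  · rw [hBo, hBe, heven]
    ring
  · rw [hBo, show 2 * m + 1 + 1 = 2 * (m + 1) by ring, hBe, hodd]
    ring

theorem toQuot_eq_of_coeff {f : PowerSeries (Polynomial ℚ)} (h0 : coeff 0 f = 1)
    (hodd : ∀ m, coeff (2 * m + 1) f = Polynomial.X * ((2 * m + 1).choose m : Polynomial ℚ))
    (heven : ∀ m, coeff (2 * m + 2) f =
      (1 + Polynomial.X ^ 2) * ((2 * m + 1).choose m : Polynomial ℚ))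
    {S : PowerSeries (Polynomial ℚ)} (hS : IsFormalSqrt (1 - 4 * tVar ^ 2) S) :
    toQuot f = 1 + (toQuot tVar * toQuot xVar + toQuot tVar ^ 2 * (1 + toQuot xVar ^ 2)) *
          ((1 - toQuot S) / (2 * toQuot tVar ^ 2 * toQuot S)) := by
  have hinj : Function.Injective (algebraMap (PowerSeries (Polynomial ℚ)) FormalQuotients) :=
    IsFractionRing.injective _ _
  have hne : (2 * tVar ^ 2 * S : PowerSeries (Polynomial ℚ)) ≠ 0 := by
    refine mul_ne_zero (mul_ne_zero ?_ (pow_ne_zero _ X_ne_zero)) ?_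
    · intro h
      have := congrArg constantCoeff h
      rw [map_ofNat, map_zero] at this
      exact two_ne_zero this
    · rintro rfl
      have := hS.1
      simp at this
  have hdiv : (1 - toQuot S) / (2 * toQuot tVar ^ 2 * toQuot S) =
      toQuot (expand 2 two_ne_zero (oddCentralBinomSeries (Polynomial ℚ))) := by
    have hne' : 2 * toQuot tVar ^ 2 * toQuot S ≠ 0 := by
      have := (map_ne_zero_iff _ hinj).2 hne
      simpa only [toQuot, map_mul, map_pow, map_ofNat] using this
    rw [div_eq_iff hne']
    have := congrArg toQuot (one_sub_formalSqrt hS)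
    simpa only [toQuot, map_sub, map_one, map_mul, map_pow, map_ofNat] using this
  rw [hdiv, eq_series_of_coeff h0 hodd heven]
  simp only [toQuot, map_add, map_one, map_mul, map_pow]

end Series

/-! ### Weights of involutions and their extension along an embedding -/

/-- `σ` is decreasing on the first `k` positions. -/
def DecreasesBelow {n : ℕ} (k : ℕ) (σ : Equiv.Perm (Fin n)) : Prop :=
  ∀ a b : Fin n, a < b → (b : ℕ) < k → σ b < σ a

theorem avoids_pattern123_iff {n : ℕ} (σ : Equiv.Perm (Fin n)) :
    AvoidsPattern σ pattern123 ↔ ∀ a b c : Fin n, a < b → b < c → σ a < σ b → ¬ σ b < σ c := by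
  constructor
  · intro h a b c hab hbc h1 h2
    refine h ⟨![a, b, c], ?_, ?_⟩
    · rw [Fin.strictMono_iff_lt_succ]
      intro i
      fin_cases i
      · exact hab
      · exact hbc
    · have : StrictMono fun i => σ (![a, b, c] i) := by
        rw [Fin.strictMono_iff_lt_succ]
        intro i
        fin_cases i
        · exact h1
        · exact h2
      intro i j
      exact this.lt_iff_lt
  · rintro h ⟨i, hi, hp⟩
    exact h (i 0) (i 1) (i 2) (hi (by decide)) (hi (by decide)) ((hp 0 1).2 (by decide))
      ((hp 1 2).2 (by decide))

/-- The sum of `X ^ fp σ` over the involutions `σ` of an `n`-element chain that satisfy `P`. -/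
noncomputable def involutionWeight {n : ℕ} (P : Equiv.Perm (Fin n) → Prop) : Polynomial ℚ :=
  open Classical in
  ∑ σ ∈ Finset.univ.filter (fun σ : Equiv.Perm (Fin n) => σ⁻¹ = σ ∧ P σ),
    (Polynomial.X : Polynomial ℚ) ^ numFixedPoints σ

theorem involutionWeight_congr {n : ℕ} {P Q : Equiv.Perm (Fin n) → Prop}
    (h : ∀ σ, σ⁻¹ = σ → (P σ ↔ Q σ)) : involutionWeight P = involutionWeight Q := by
  unfold involutionWeight
  congr 1
  ext σ
  simp only [Finset.mem_filter, Finset.mem_univ, true_and]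
  exact and_congr_right (h σ)

theorem involutionWeight_eq_zero {n : ℕ} {P : Equiv.Perm (Fin n) → Prop}
    (h : ∀ σ, σ⁻¹ = σ → ¬ P σ) : involutionWeight P = 0 := by
  unfold involutionWeight
  rw [Finset.sum_eq_zero]
  intro σ hσ
  simp only [Finset.mem_filter, Finset.mem_univ, true_and] at hσ
  exact absurd hσ.2 (h σ hσ.1)

theorem involutionWeight_fiberwise {n : ℕ} (P : Equiv.Perm (Fin n) → Prop) (i : Fin n) :
    involutionWeight P = ∑ v, involutionWeight fun σ => σ i = v ∧ P σ := by
  classical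
  unfold involutionWeight
  rw [← Finset.sum_fiberwise _ (fun σ : Equiv.Perm (Fin n) => σ i)]
  refine Finset.sum_congr rfl fun v _ => ?_
  congr 1
  ext σ
  simp only [Finset.mem_filter, Finset.mem_univ, true_and]
  tauto

theorem apply_apply_of_inv_eq {α : Type*} {σ : Equiv.Perm α} (h : σ⁻¹ = σ) (a : α) :
    σ (σ a) = a := by
  nth_rewrite 1 [← h]
  exact σ.symm_apply_apply a

theorem inv_eq_of_apply_apply {α : Type*} {σ : Equiv.Perm α} (h : ∀ a, σ (σ a) = a) :
    σ⁻¹ = σ := by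
  ext a
  rw [Equiv.Perm.inv_eq_iff_eq, h]

/-- The involutions that restrict to a given involution `τ` off the range of an embedding `e` are
the extensions of the involutions of the domain of `e`. -/
theorem involutionWeight_extend {m n : ℕ} (e : Fin m ↪o Fin n) (τ : Equiv.Perm (Fin n))
    (hτ : ∀ a, τ (τ a) = a) (hτe : ∀ i, τ (e i) = e i) (f : ℕ)
    (hf : (Finset.univ.filter fun y => τ y = y ∧ y ∉ Set.range e).card = f)
    (P : Equiv.Perm (Fin n) → Prop) (Q : Equiv.Perm (Fin m) → Prop)
    (hPQ : ∀ (σ : Equiv.Perm (Fin n)) (ρ : Equiv.Perm (Fin m)), (∀ a, σ (σ a) = a) →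
      (∀ a, ρ (ρ a) = a) → (∀ i, σ (e i) = e (ρ i)) → (∀ y, y ∉ Set.range e → σ y = τ y) →
      (P σ ↔ Q ρ)) :
    involutionWeight (fun σ => (∀ y, y ∉ Set.range e → σ y = τ y) ∧ P σ) =
      Polynomial.X ^ f * involutionWeight Q := by
  classical
  unfold involutionWeight
  rw [Finset.mul_sum]
  symm
  set E : Equiv.Perm (Fin m) → Equiv.Perm (Fin n) :=
    fun ρ => τ * ρ.viaFintypeEmbedding e.toEmbedding with hE
  have hEe : ∀ ρ i, E ρ (e i) = e (ρ i) := by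
    intro ρ i
    have := ρ.viaFintypeEmbedding_apply_image e.toEmbedding i
    rw [hE, Equiv.Perm.mul_apply]
    change τ (ρ.viaFintypeEmbedding e.toEmbedding (e.toEmbedding i)) = _
    rw [this]
    exact hτe _
  have hEn : ∀ ρ y, y ∉ Set.range e → E ρ y = τ y := by
    intro ρ y hy
    rw [hE, Equiv.Perm.mul_apply, Equiv.Perm.viaFintypeEmbedding_apply_notMem_range _ _ hy]
  have hτn : ∀ y, y ∉ Set.range e → τ y ∉ Set.range e := by
    rintro y hy ⟨i, hi⟩
    refine hy ⟨i, ?_⟩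
    rw [← hτe, hi, hτ]
  have hinv : ∀ ρ, (∀ a, ρ (ρ a) = a) → ∀ a, E ρ (E ρ a) = a := by
    intro ρ hρ a
    by_cases ha : a ∈ Set.range e
    · obtain ⟨i, rfl⟩ := ha
      rw [hEe, hEe, hρ]
    · rw [hEn _ _ ha, hEn _ _ (hτn _ ha), hτ]
  refine Finset.sum_bij (fun ρ _ => E ρ) ?_ ?_ ?_ ?_
  · intro ρ hρ
    simp only [Finset.mem_filter, Finset.mem_univ, true_and] at hρ ⊢
    have h1 := apply_apply_of_inv_eq hρ.1
    have h2 := hinv ρ h1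
    exact ⟨inv_eq_of_apply_apply h2, hEn ρ, (hPQ _ _ h2 h1 (hEe ρ) (hEn ρ)).2 hρ.2⟩
  · intro ρ _ ρ' _ h
    ext1 i
    apply e.injective
    rw [← hEe, ← hEe, h]
  · intro σ hσ
    simp only [Finset.mem_filter, Finset.mem_univ, true_and] at hσ
    obtain ⟨hσ1, hσ2, hσ3⟩ := hσ
    have hσσ := apply_apply_of_inv_eq hσ1
    -- `σ` preserves the range: were `σ (e i)` outside it, `τ` would send `σ (e i)` back to `e i`,
    -- which `τ` fixes, forcing `σ (e i) = e i`.
    have hr : ∀ i, ∃ j, e j = σ (e i) := by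
      intro i
      by_contra hc
      have h1 := hσ2 _ hc
      rw [hσσ] at h1
      apply hc
      refine ⟨i, ?_⟩
      exact τ.injective ((hτe i).trans h1)
    choose g hg using hr
    have hgg : ∀ i, g (g i) = i := by
      intro i
      apply e.injective
      rw [hg, hg, hσσ]
    let ρ : Equiv.Perm (Fin m) := ⟨g, g, hgg, hgg⟩
    have hρe : ∀ i, σ (e i) = e (ρ i) := fun i => (hg i).symm
    refine ⟨ρ, ?_, ?_⟩
    · simp only [Finset.mem_filter, Finset.mem_univ, true_and]
      exact ⟨inv_eq_of_apply_apply hgg, (hPQ σ ρ hσσ hgg hρe hσ2).1 hσ3⟩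
    · ext1 y
      by_cases hy : y ∈ Set.range e
      · obtain ⟨i, rfl⟩ := hy
        rw [hEe, hρe]
      · rw [hEn _ _ hy, hσ2 _ hy]
  · intro ρ _
    rw [← pow_add]
    congr 1
    unfold numFixedPoints
    have : (Finset.univ.filter fun y => E ρ y = y) =
        (Finset.univ.filter fun y => τ y = y ∧ y ∉ Set.range e) ∪
        (Finset.univ.filter fun i => ρ i = i).map e.toEmbedding := by
      ext y
      simp only [Finset.mem_filter, Finset.mem_univ, true_and, Finset.mem_union, Finset.mem_map]
      constructor
      · intro h
        by_cases hy : y ∈ Set.range e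
        · obtain ⟨i, rfl⟩ := hy
          rw [hEe] at h
          exact Or.inr ⟨i, e.injective h, rfl⟩
        · rw [hEn _ _ hy] at h
          exact Or.inl ⟨h, hy⟩
      · rintro (⟨h, hy⟩ | ⟨i, hi, rfl⟩)
        · rw [hEn _ _ hy, h]
        · change E ρ (e i) = e i
          rw [hEe, hi]
    rw [this, Finset.card_union_of_disjoint, hf, Finset.card_map]
    rw [Finset.disjoint_left]
    intro y hy hy'
    simp only [Finset.mem_filter, Finset.mem_univ, true_and, Finset.mem_map] at hy hy'
    obtain ⟨i, _, rfl⟩ := hy'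
    exact hy.2 ⟨i, rfl⟩

/-! ### Weights by decreasing prefix -/

/-- The sum of `X ^ fp σ` over the `123`-avoiding involutions `σ` of an `n`-element chain that are
decreasing on the first `k` positions. -/
noncomputable def decreasingWeight (n k : ℕ) : Polynomial ℚ :=
  involutionWeight fun σ : Equiv.Perm (Fin n) => AvoidsPattern σ pattern123 ∧ DecreasesBelow k σ

theorem coeff_fixedPointSeries (n : ℕ) :
    PowerSeries.coeff n (fixedPointSeries pattern123) = decreasingWeight n 0 := by
  classical
  rw [fixedPointSeries, PowerSeries.coeff_mk, avoidingInvolutions, decreasingWeight,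
    involutionWeight]
  congr 1
  ext σ
  simp only [Finset.mem_filter, Finset.mem_univ, true_and]
  have : DecreasesBelow 0 σ := fun a b _ hb => absurd hb (Nat.not_lt_zero _)
  tauto

/-- Both prefix conditions are vacuous. This is the boundary rule at height 0 of the path recursion.
-/
theorem decreasingWeight_zero (n : ℕ) : decreasingWeight n 0 = decreasingWeight n 1 := by
  refine involutionWeight_congr fun σ _ => and_congr_right fun _ => ?_
  constructor
  · intro _ a b hab hb
    have : (a : ℕ) < b := hab
    omega
  · intro _ a b _ hb
    omega

theorem numFixedPoints_revPerm (n : ℕ) :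
    numFixedPoints (Fin.revPerm : Equiv.Perm (Fin n)) = n % 2 := by
  unfold numFixedPoints
  rcases Nat.even_or_odd' n with ⟨m, rfl | rfl⟩
  · rw [Finset.card_eq_zero.2, Nat.mul_mod_right]
    rw [Finset.filter_eq_empty_iff]
    intro i _ h
    have := congrArg Fin.val h
    rw [Fin.revPerm_apply, Fin.val_rev] at this
    omega
  · have h1 : (2 * m + 1) % 2 = 1 := by omega
    rw [h1, Finset.card_eq_one]
    refine ⟨⟨m, by omega⟩, ?_⟩
    ext i
    simp only [Finset.mem_filter, Finset.mem_univ, true_and, Finset.mem_singleton, Fin.ext_iff,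
      Fin.revPerm_apply, Fin.val_rev]
    omega

theorem decreasesBelow_self_iff {n : ℕ} (σ : Equiv.Perm (Fin n)) :
    DecreasesBelow n σ ↔ σ = Fin.revPerm := by
  constructor
  · intro h
    have hm : StrictMono fun i => Fin.rev (σ i) := fun a b hab => Fin.rev_lt_rev.2 (h a b hab b.2)
    have hs : Function.Surjective fun i => Fin.rev (σ i) :=
      Fin.rev_surjective.comp σ.surjective
    -- A finite chain has only one order automorphism.
    have := Subsingleton.elim (hm.orderIsoOfSurjective _ hs) (OrderIso.refl (Fin n))
    ext1 i
    have hi : Fin.rev (σ i) = i := congrArg (fun f : Fin n ≃o Fin n => f i) this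
    rw [Fin.revPerm_apply, ← Fin.rev_rev (σ i), hi]
  · rintro rfl a b hab _
    exact Fin.rev_lt_rev.2 hab

theorem decreasingWeight_self (n : ℕ) : decreasingWeight n n = Polynomial.X ^ (n % 2) := by
  rw [decreasingWeight, involutionWeight, ← numFixedPoints_revPerm n]
  apply Finset.sum_eq_single
  · intro σ hσ hne
    simp only [Finset.mem_filter, decreasesBelow_self_iff] at hσ
    exact absurd hσ.2.2.2 hne
  · intro h
    simp only [Finset.mem_filter, decreasesBelow_self_iff, avoids_pattern123_iff] at h
    exact absurd ⟨Finset.mem_univ _, rfl,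
      fun a b c hab _ h1 _ => absurd (Fin.rev_lt_rev.1 h1) hab.asymm, trivial⟩ h

/-! ### Removing the last element -/

theorem decreasingWeight_fiber_last_last (n k : ℕ) (hk : k ≤ n) :
    involutionWeight (fun σ : Equiv.Perm (Fin (n + 1)) => σ (Fin.last n) = Fin.last n ∧
      AvoidsPattern σ pattern123 ∧ DecreasesBelow k σ) =
      Polynomial.X * decreasingWeight n n := by
  have hr : ∀ y : Fin (n + 1), y ∉ Set.range (Fin.castSuccOrderEmb (n := n)) ↔ y = Fin.last n := by
    intro y
    cases y using Fin.lastCases with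
    | last => simp
    | cast i => simp [Fin.castSucc_ne_last]
  have := involutionWeight_extend (Fin.castSuccOrderEmb (n := n)) 1 (fun _ => rfl) (fun _ => rfl) 1
    (by
      rw [Finset.card_eq_one]
      refine ⟨Fin.last n, ?_⟩
      ext y
      rw [Finset.mem_filter, hr]
      simp)
    (fun σ => AvoidsPattern σ pattern123 ∧ DecreasesBelow k σ)
    (fun ρ => AvoidsPattern ρ pattern123 ∧ DecreasesBelow n ρ) (by
      intro σ ρ _ _ he ht
      have hl : σ (Fin.last n) = Fin.last n := ht _ ((hr _).2 rfl)
      have he' : ∀ i : Fin n, σ i.castSucc = (ρ i).castSucc := he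
      simp only [avoids_pattern123_iff]
      constructor
      · rintro ⟨h, _⟩
        -- An ascent before the fixed last point would complete a 123 with it.
        have hd : DecreasesBelow n ρ := by
          intro a b hab _
          by_contra hc
          have hlt : ρ a < ρ b := lt_of_le_of_ne (not_lt.1 hc) fun h => hab.ne (ρ.injective h)
          refine h a.castSucc b.castSucc (Fin.last n) (Fin.castSucc_lt_castSucc_iff.2 hab)
            (Fin.castSucc_lt_last _) ?_ ?_
          · rwa [he', he', Fin.castSucc_lt_castSucc_iff]
          · rw [he', hl]
            exact Fin.castSucc_lt_last _
        exact ⟨fun a b c hab _ h1 _ => h1.asymm (hd a b hab b.2), hd⟩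
      · rintro ⟨_, hd⟩
        have key : ∀ a b : Fin (n + 1), a < b → b ≠ Fin.last n → σ b < σ a := by
          intro a b hab hb
          obtain ⟨b, rfl⟩ := Fin.exists_castSucc_eq.2 hb
          obtain ⟨a, rfl⟩ := Fin.exists_castSucc_eq.2 (hab.trans (Fin.castSucc_lt_last b)).ne
          rw [he', he', Fin.castSucc_lt_castSucc_iff]
          exact hd a b (Fin.castSucc_lt_castSucc_iff.1 hab) b.2
        refine ⟨fun a b c hab hbc h1 _ => h1.asymm (key a b hab (hbc.trans_le (Fin.le_last c)).ne),
          fun a b hab hb => key a b hab ?_⟩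
        rintro rfl
        rw [Fin.val_last] at hb
        omega)
  rw [pow_one] at this
  rw [decreasingWeight, ← this]
  refine involutionWeight_congr fun σ _ => and_congr_left fun _ => ?_
  simp only [hr, forall_eq, Equiv.Perm.one_apply]

/-- The order embedding of `Fin n` into `Fin (n + 2)` that misses `j` and the last element. -/
def skipOrderEmb {n : ℕ} (j : Fin (n + 1)) : Fin n ↪o Fin (n + 2) :=
  (Fin.succAboveOrderEmb j).trans Fin.castSuccOrderEmb

theorem skipOrderEmb_apply {n : ℕ} (j : Fin (n + 1)) (i : Fin n) :
    skipOrderEmb j i = (j.succAbove i).castSucc := rfl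

theorem notMem_range_skipOrderEmb {n : ℕ} (j : Fin (n + 1)) (y : Fin (n + 2)) :
    y ∉ Set.range (skipOrderEmb j) ↔ y = j.castSucc ∨ y = Fin.last (n + 1) := by
  rw [iff_comm, ← not_iff_not, not_not]
  push Not
  constructor
  · rintro ⟨h1, h2⟩
    obtain ⟨y, rfl⟩ := Fin.exists_castSucc_eq.2 h2
    obtain ⟨i, rfl⟩ := Fin.exists_succAbove_eq fun h => h1 (congrArg Fin.castSucc h)
    exact ⟨i, rfl⟩
  · rintro ⟨i, rfl⟩
    exact ⟨fun h => Fin.succAbove_ne j i (Fin.castSucc_injective _ h), Fin.castSucc_ne_last _⟩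

theorem exists_skipOrderEmb_eq {n : ℕ} {j : Fin (n + 1)} {y : Fin (n + 2)} (h1 : y ≠ j.castSucc)
    (h2 : y ≠ Fin.last (n + 1)) : ∃ i, skipOrderEmb j i = y := by
  by_contra h
  exact ((notMem_range_skipOrderEmb j y).1 h).elim h1 h2

/-- Deletion of the `2`-cycle formed by `j` and the last element. -/
theorem involutionWeight_fiber_last {n : ℕ} (j : Fin (n + 1)) (P : Equiv.Perm (Fin (n + 2)) → Prop)
    (Q : Equiv.Perm (Fin n) → Prop)
    (hPQ : ∀ (σ : Equiv.Perm (Fin (n + 2))) (ρ : Equiv.Perm (Fin n)), (∀ a, ρ (ρ a) = a) →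
      (∀ i, σ (skipOrderEmb j i) = skipOrderEmb j (ρ i)) → σ j.castSucc = Fin.last (n + 1) →
      σ (Fin.last (n + 1)) = j.castSucc → (P σ ↔ Q ρ)) :
    involutionWeight (fun σ => σ (Fin.last (n + 1)) = j.castSucc ∧ P σ) = involutionWeight Q := by
  have hj : j.castSucc ≠ Fin.last (n + 1) := Fin.castSucc_ne_last j
  have := involutionWeight_extend (skipOrderEmb j) (Equiv.swap j.castSucc (Fin.last (n + 1)))
    (fun _ => Equiv.swap_apply_self _ _ _)
    (fun i => by
      have h : ¬ skipOrderEmb j i ∉ Set.range (skipOrderEmb j) := fun h => h ⟨i, rfl⟩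
      rw [notMem_range_skipOrderEmb] at h
      push Not at h
      exact Equiv.swap_apply_of_ne_of_ne h.1 h.2)
    0
    (by
      rw [Finset.card_eq_zero, Finset.filter_eq_empty_iff]
      rintro y _ ⟨h, hy⟩
      rcases (notMem_range_skipOrderEmb j y).1 hy with rfl | rfl
      · rw [Equiv.swap_apply_left] at h
        exact hj h.symm
      · rw [Equiv.swap_apply_right] at h
        exact hj h)
    P Q (fun σ ρ _ hρ he ht => hPQ σ ρ hρ he
      ((ht _ ((notMem_range_skipOrderEmb _ _).2 (Or.inl rfl))).trans (Equiv.swap_apply_left _ _))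
      ((ht _ ((notMem_range_skipOrderEmb _ _).2 (Or.inr rfl))).trans (Equiv.swap_apply_right _ _)))
  rw [pow_zero, one_mul] at this
  rw [← this]
  refine involutionWeight_congr fun σ hσ => and_congr_left fun _ => ?_
  have hσσ := apply_apply_of_inv_eq hσ
  constructor
  · intro h y hy
    rcases (notMem_range_skipOrderEmb j y).1 hy with rfl | rfl
    · rw [Equiv.swap_apply_left, ← h, hσσ]
    · rw [Equiv.swap_apply_right, h]
  · intro h
    rw [h _ ((notMem_range_skipOrderEmb _ _).2 (Or.inr rfl)), Equiv.swap_apply_right]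

theorem avoids_pattern123_of_intertwines {m n : ℕ} {e : Fin m ↪o Fin n} {σ : Equiv.Perm (Fin n)}
    {ρ : Equiv.Perm (Fin m)} (he : ∀ i, σ (e i) = e (ρ i)) (h : AvoidsPattern σ pattern123) :
    AvoidsPattern ρ pattern123 := by
  rw [avoids_pattern123_iff] at h ⊢
  intro a b c hab hbc h1 h2
  refine h (e a) (e b) (e c) (e.lt_iff_lt.2 hab) (e.lt_iff_lt.2 hbc) ?_ ?_
  · rwa [he, he, e.lt_iff_lt]
  · rwa [he, he, e.lt_iff_lt]

/-- The first entry is maximal and the last minimal, so neither takes part in a 123; deletion only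
shortens the decreasing prefix by one. -/
theorem decreasingWeight_fiber_last_zero (n k : ℕ) (hk : k ≤ n) :
    involutionWeight (fun σ : Equiv.Perm (Fin (n + 2)) => σ (Fin.last (n + 1)) = Fin.castSucc 0 ∧
      AvoidsPattern σ pattern123 ∧ DecreasesBelow (k + 1) σ) = decreasingWeight n k := by
  refine involutionWeight_fiber_last 0 _ _ fun σ ρ _ he h0 hl => ?_
  have hv : ∀ i : Fin n, (skipOrderEmb 0 i : ℕ) = i + 1 := fun i => by
    simp [skipOrderEmb_apply]
  have hmax : ∀ a : Fin (n + 2), ¬ Fin.last (n + 1) < a := fun a => not_lt.2 (Fin.le_last a)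
  have hmin : ∀ a : Fin (n + 2), ¬ a < Fin.castSucc 0 := fun a => not_lt.2 (Fin.zero_le a)
  constructor
  · rintro ⟨h, hd⟩
    refine ⟨avoids_pattern123_of_intertwines he h, fun a b hab hb => ?_⟩
    have := hd _ _ ((skipOrderEmb 0).lt_iff_lt.2 hab) (by rw [hv]; omega)
    rwa [he, he, OrderEmbedding.lt_iff_lt] at this
  · rintro ⟨h, hd⟩
    rw [avoids_pattern123_iff] at h ⊢
    constructor
    · intro a b c hab hbc h1 h2
      have ha0 : a ≠ Fin.castSucc 0 := by
        rintro rfl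
        rw [h0] at h1
        exact hmax _ h1
      have hb0 : b ≠ Fin.castSucc 0 := by
        rintro rfl
        exact hmin _ hab
      have hc0 : c ≠ Fin.castSucc 0 := by
        rintro rfl
        exact hmin _ hbc
      have hcl : c ≠ Fin.last (n + 1) := by
        rintro rfl
        rw [hl] at h2
        exact hmin _ h2
      have hbl : b ≠ Fin.last (n + 1) := (hbc.trans_le (Fin.le_last _)).ne
      have hal : a ≠ Fin.last (n + 1) := (hab.trans_le (Fin.le_last _)).ne
      obtain ⟨a, rfl⟩ := exists_skipOrderEmb_eq ha0 hal
      obtain ⟨b, rfl⟩ := exists_skipOrderEmb_eq hb0 hbl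
      obtain ⟨c, rfl⟩ := exists_skipOrderEmb_eq hc0 hcl
      simp only [he, OrderEmbedding.lt_iff_lt] at hab hbc h1 h2
      exact h a b c hab hbc h1 h2
    · intro a b hab hb
      have hb0 : b ≠ Fin.castSucc 0 := by
        rintro rfl
        exact hmin _ hab
      have hbl : b ≠ Fin.last (n + 1) := by
        rintro rfl
        rw [Fin.val_last] at hb
        omega
      have hal : a ≠ Fin.last (n + 1) := (hab.trans_le (Fin.le_last _)).ne
      obtain ⟨b, rfl⟩ := exists_skipOrderEmb_eq hb0 hbl
      by_cases ha0 : a = Fin.castSucc 0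
      · rw [ha0, h0, he]
        exact Fin.castSucc_lt_last _
      · obtain ⟨a, rfl⟩ := exists_skipOrderEmb_eq ha0 hal
        rw [hv] at hb
        rw [OrderEmbedding.lt_iff_lt] at hab
        rw [he, he, OrderEmbedding.lt_iff_lt]
        exact hd a b hab (by omega)

/-- The entry at position `j + 1` is maximal, so avoidance makes the `j + 1` positions before it
decrease. If `j < k`, that position lies in the prefix, where a maximal entry after position 0 is
impossible. -/
theorem decreasingWeight_fiber_last_succ (n k : ℕ) (hk : k ≤ n) (j : Fin n) :
    involutionWeight (fun σ : Equiv.Perm (Fin (n + 2)) => σ (Fin.last (n + 1)) = j.succ.castSucc ∧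
      AvoidsPattern σ pattern123 ∧ DecreasesBelow (k + 1) σ) =
      if k ≤ j then decreasingWeight n (j + 1) else 0 := by
  have hj : (j.succ.castSucc : ℕ) = j + 1 := by simp
  split_ifs with hkj
  · refine involutionWeight_fiber_last j.succ _ _ fun σ ρ hρ he h0 hl => ?_
    have hlt : ∀ i : Fin n, skipOrderEmb j.succ i < j.succ.castSucc ↔ (i : ℕ) < j + 1 := by
      intro i
      rw [skipOrderEmb_apply, Fin.castSucc_lt_castSucc_iff, Fin.succAbove_lt_iff_castSucc_lt]
      rw [Fin.lt_def]
      simp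
    have hmax : ∀ a : Fin (n + 2), ¬ Fin.last (n + 1) < a := fun a => not_lt.2 (Fin.le_last a)
    constructor
    · rintro ⟨h, _⟩
      refine ⟨avoids_pattern123_of_intertwines he h, fun a b hab hb => ?_⟩
      rw [avoids_pattern123_iff] at h
      by_contra hc
      have hlt' : ρ a < ρ b := lt_of_le_of_ne (not_lt.1 hc) fun h => hab.ne (ρ.injective h)
      refine h _ _ _ ((skipOrderEmb j.succ).lt_iff_lt.2 hab) ((hlt b).2 hb) ?_ ?_
      · rwa [he, he, OrderEmbedding.lt_iff_lt]
      · rw [he, h0]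
        exact Fin.castSucc_lt_last _
    · rintro ⟨h, hd⟩
      rw [avoids_pattern123_iff] at h ⊢
      constructor
      · intro a b c hab hbc h1 h2
        have haj : a ≠ j.succ.castSucc := by
          rintro rfl
          rw [h0] at h1
          exact hmax _ h1
        have hbj : b ≠ j.succ.castSucc := by
          rintro rfl
          rw [h0] at h2
          exact hmax _ h2
        have hbl : b ≠ Fin.last (n + 1) := (hbc.trans_le (Fin.le_last _)).ne
        have hal : a ≠ Fin.last (n + 1) := (hab.trans_le (Fin.le_last _)).ne
        obtain ⟨a, rfl⟩ := exists_skipOrderEmb_eq haj hal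
        obtain ⟨b, rfl⟩ := exists_skipOrderEmb_eq hbj hbl
        rw [OrderEmbedding.lt_iff_lt] at hab
        rw [he, he, OrderEmbedding.lt_iff_lt] at h1
        by_cases hcj : c = j.succ.castSucc
        · rw [hcj, hlt] at hbc
          exact h1.asymm (hd a b hab hbc)
        -- A 123 ending at the last position has its middle value below `j + 1`; applying the
        -- decrease of `ρ` to the values `ρ a < ρ b` and using that `ρ` is an involution gives `b <
        -- a`.
        by_cases hcl : c = Fin.last (n + 1)
        · rw [hcl, he, hl, hlt] at h2
          have := hd _ _ h1 h2
          rw [hρ, hρ] at this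
          exact hab.asymm this
        obtain ⟨c, rfl⟩ := exists_skipOrderEmb_eq hcj hcl
        rw [OrderEmbedding.lt_iff_lt] at hbc
        rw [he, he, OrderEmbedding.lt_iff_lt] at h2
        exact h a b c hab hbc h1 h2
      · intro a b hab hb
        have hal : a ≠ Fin.last (n + 1) := (hab.trans_le (Fin.le_last _)).ne
        have haj : a ≠ j.succ.castSucc := by
          rintro rfl
          rw [Fin.lt_def] at hab
          omega
        have hbl : b ≠ Fin.last (n + 1) := by
          rintro rfl
          rw [Fin.val_last] at hb
          omega
        obtain ⟨a, rfl⟩ := exists_skipOrderEmb_eq haj hal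
        by_cases hbj : b = j.succ.castSucc
        · exfalso
          rw [hbj] at hb
          omega
        obtain ⟨b, rfl⟩ := exists_skipOrderEmb_eq hbj hbl
        have hb' : (b : ℕ) < j + 1 := by
          rw [← hlt, Fin.lt_def]
          omega
        rw [OrderEmbedding.lt_iff_lt] at hab
        rw [he, he, OrderEmbedding.lt_iff_lt]
        exact hd a b hab hb'
  · refine involutionWeight_eq_zero fun σ hσ h => ?_
    obtain ⟨hl, _, hd⟩ := h
    have h0 : σ j.succ.castSucc = Fin.last (n + 1) := by
      rw [← hl, apply_apply_of_inv_eq hσ]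
    have := hd 0 j.succ.castSucc (by rw [Fin.lt_def]; simp) (by omega)
    rw [h0] at this
    exact absurd this (not_lt.2 (Fin.le_last _))

theorem decreasingWeight_add_two (n k : ℕ) (hk : k ≤ n) :
    decreasingWeight (n + 2) (k + 1) = decreasingWeight n k +
      ∑ j ∈ Finset.range n, (if k ≤ j then decreasingWeight n (j + 1) else 0) +
        Polynomial.X * decreasingWeight (n + 1) (n + 1) := by
  rw [decreasingWeight, involutionWeight_fiberwise _ (Fin.last (n + 1)), Fin.sum_univ_castSucc,
    decreasingWeight_fiber_last_last (n + 1) (k + 1) (by omega), Fin.sum_univ_succ,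
    decreasingWeight_fiber_last_zero n k hk]
  simp only [decreasingWeight_fiber_last_succ n k hk]
  rw [Fin.sum_univ_eq_sum_range fun j => if k ≤ j then decreasingWeight n (j + 1) else 0]

theorem decreasingWeight_add_two_self (n : ℕ) :
    decreasingWeight (n + 2) (n + 1) =
      decreasingWeight n n + Polynomial.X * decreasingWeight (n + 1) (n + 1) := by
  rw [decreasingWeight_add_two n n le_rfl, Finset.sum_eq_zero, add_zero]
  intro j hj
  rw [if_neg (not_le.2 (Finset.mem_range.1 hj))]

/-- The sums for `k` and `k + 1` differ only in the term `j = k`, which is exactly the leading term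
`decreasingWeight n (k + 1)` of the second expansion. -/
theorem decreasingWeight_add_two_of_lt (n k : ℕ) (hk : k < n) :
    decreasingWeight (n + 2) (k + 1) =
      decreasingWeight n k + decreasingWeight (n + 2) (k + 2) := by
  have hs : ∑ j ∈ Finset.range n, (if k ≤ j then decreasingWeight n (j + 1) else 0) =
      decreasingWeight n (k + 1) +
        ∑ j ∈ Finset.range n, (if k + 1 ≤ j then decreasingWeight n (j + 1) else 0) := by
    rw [← Finset.sum_ite_eq_of_mem' (Finset.range n) k (fun j => decreasingWeight n (j + 1))
      (Finset.mem_range.2 hk), ← Finset.sum_add_distrib]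
    refine Finset.sum_congr rfl fun j _ => ?_
    rcases lt_trichotomy j k with h | h | h
    · rw [if_neg (by omega), if_neg (by omega), if_neg (by omega), add_zero]
    · rw [if_pos (by omega), if_pos (by omega), if_neg (by omega), add_zero]
    · rw [if_pos (by omega), if_neg (by omega), if_pos (by omega), zero_add]
  rw [decreasingWeight_add_two n k hk.le, decreasingWeight_add_two n (k + 1) hk, hs]
  ring

/-! ### Solving the recursion by lattice paths -/

theorem decreasingWeight_of_odd (N h : ℕ) (hN : (N + h) % 2 = 1) :
    decreasingWeight (N + h) h = Polynomial.X * (ballotPaths N h : Polynomial ℚ) := by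
  induction N using Nat.strong_induction_on generalizing h with
  | _ N ih =>
    -- The case of one step is a second base case, since the difference recursion requires `k < n`.
    -- For positive height its two contributions are both `X`.
    rcases N with _ | _ | N
    · rw [zero_add] at hN ⊢
      rw [decreasingWeight_self, hN]
      simp [ballotPaths]
    · rcases h with _ | h
      · rw [decreasingWeight_zero, add_zero, zero_add, decreasingWeight_self]
        simp [ballotPaths]
      · rw [show 0 + 1 + (h + 1) = h + 2 by ring, decreasingWeight_add_two_self,
          decreasingWeight_self, decreasingWeight_self, show h % 2 = 1 by omega,
          show (h + 1) % 2 = 0 by omega]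
        simp only [ballotPaths]
        push_cast
        ring
    · rcases h with _ | h
      · have := ih (N + 1) (by omega) 1 (by omega)
        rw [decreasingWeight_zero, add_zero, this]
        rfl
      · have h1 := ih (N + 1) (by omega) h (by omega)
        have h2 := ih (N + 1) (by omega) (h + 2) (by omega)
        rw [show N + 1 + (h + 2) = N + 1 + h + 2 by ring] at h2
        rw [show N + 1 + 1 + (h + 1) = N + 1 + h + 2 by ring,
          decreasingWeight_add_two_of_lt _ _ (by omega), h1, h2,
          show ballotPaths (N + 1 + 1) (h + 1) =
            ballotPaths (N + 1) h + ballotPaths (N + 1) (h + 2) from rfl]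
        push_cast
        ring

/-- The paths start one layer above the diagonal, whence `N + 1`: there the weight is already `1 + X
^ 2`, with 1 from the cycle through the first and last positions and `X ^ 2` from two fixed points.
-/
theorem decreasingWeight_of_even (N h : ℕ) (hN : (N + h) % 2 = 1) :
    decreasingWeight (N + 1 + h) h =
      (1 + Polynomial.X ^ 2) * (ballotPaths N h : Polynomial ℚ) := by
  induction N generalizing h with
  | zero =>
    rcases h with _ | h
    · omega
    · rw [show 0 + 1 + (h + 1) = h + 2 by ring, decreasingWeight_add_two_self,
        decreasingWeight_self, decreasingWeight_self, show h % 2 = 0 by omega,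
        show (h + 1) % 2 = 1 by omega]
      simp only [ballotPaths]
      push_cast
      ring
  | succ N ih =>
    rcases h with _ | h
    · rw [decreasingWeight_zero, add_zero, ih 1 (by omega)]
      rfl
    · have h1 := ih h (by omega)
      have h2 := ih (h + 2) (by omega)
      rw [show N + 1 + (h + 2) = N + 1 + h + 2 by ring] at h2
      rw [show N + 1 + 1 + (h + 1) = N + 1 + h + 2 by ring,
        decreasingWeight_add_two_of_lt _ _ (by omega), h1, h2, ballotPaths]
      push_cast
      ring

/-- The power series `1 - 4 t ^ 2` has exactly one formal square root `S` with constant term `1`,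
and for this `S` the fixed-point generating function of the `123`-avoiding involutions is
`1 + (t x + t ^ 2 (1 + x ^ 2)) (1 - S) / (2 t ^ 2 S)`, an identity in the field of fractions of
`ℚ[x]⟦t⟧`. -/
theorem mainTheorem8 :
    (∃! S : PowerSeries (Polynomial ℚ), IsFormalSqrt (1 - 4 * tVar ^ 2) S) ∧
    ∀ S : PowerSeries (Polynomial ℚ), IsFormalSqrt (1 - 4 * tVar ^ 2) S →
      toQuot (fixedPointSeries pattern123) =
        1 + (toQuot tVar * toQuot xVar + toQuot tVar ^ 2 * (1 + toQuot xVar ^ 2)) *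
          ((1 - toQuot S) / (2 * toQuot tVar ^ 2 * toQuot S)) := by
  refine ⟨⟨_, isFormalSqrt_expand_centralBinomSeries_mul, fun T hT =>
    isFormalSqrt_unique hT isFormalSqrt_expand_centralBinomSeries_mul⟩, fun S hS => ?_⟩
  refine toQuot_eq_of_coeff ?_ (fun m => ?_) (fun m => ?_) hS
  · rw [coeff_fixedPointSeries, decreasingWeight_self]
    simp
  · have := decreasingWeight_of_odd (2 * m + 1) 0 (by omega)
    rw [coeff_fixedPointSeries, ← ballotPaths_two_mul_add_one_zero]
    exact this
  · have := decreasingWeight_of_even (2 * m + 1) 0 (by omega)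
    rw [coeff_fixedPointSeries, ← ballotPaths_two_mul_add_one_zero]
    exact this
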